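/- Let $X$ be a connected CW complex with base point $x_0$, let $G=\pi_1(X,x_0)$, and let $\tilde X$ be the universal covering space of $X$, on which $G$ acts from the right by deck transformations. For a left $\mathbb{Z}[G]$-module $M$ let $H_i(X;M)=H_i\bigl(C_*(\tilde X)\otimes_{\mathbb{Z}[G]}M\bigr)$ denote the homology of $X$ with (local) coefficients in $M$, where $C_*(\tilde X)$ is the singular chain complex of $\tilde X$, viewed as a complex of right $\mathbb{Z}[G]$-modules. (a) Let $R'$ be a unital associative ring (not necessarily commutative) which is also a left $\mathbb{Z}[G]$-module such that $z(ab)=(za)b$ for all $z\in\mathbb{Z}[G]$ and $a,b\in R'$ (equivalently, the module structure comes from a ring homomorphism $\mathbb{Z}[G]\to R'$). Let $R$ be a left $R'$-module which is also a left $\mathbb{Z}[G]$-module such that $z(ar)=(za)r$ for all $z\in\mathbb{Z}[G]$, $a\in R'$, $r\in R$. Suppose that $R'\subseteq R$ as left $R'$-modules (that is, an injective $R'$-linear map $R'\to R$ is given) and that $R/R'$ is a flat left $R'$-module. Then for every integer $n\ge 0$ the following are equivalent: (i) $H_i(X;R')=0$ for all $0\le i\le n$; (ii) $H_i(X;R)=0$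 for all $0\le i\le n$. (b) In particular, let $C^*_r(G)$ (respectively $C^*_{\mathbb{R}}(G)$) be the closure, in the operator norm, of the image of $\mathbb{C}[G]$ (respectively $\mathbb{R}[G]$) in the bounded operators on the complex Hilbert space $l^2(G)$ under the left regular representation, viewed as a left $\mathbb{Z}[G]$-module through the canonical ring homomorphism from $\mathbb{Z}[G]$. Then for every integer $n\ge 0$, $H_i(X;C^*_{\mathbb{R}}(G))=0$ for all $0\le i\le n$ if and only if $H_i(X;C^*_r(G))=0$ for all $0\le i\le n$. -/

import Mathlib

open CategoryTheory MulOpposite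
open scoped TensorProduct unitInterval

universe u

noncomputable section

namespace FlatCoeff

/-! ### Tensor products and flatness over a noncommutative ring -/

section Tensor

variable (A : Type*) [Ring A] (M : Type*) [AddCommGroup M] [Module Aᵐᵒᵖ M]
  (N : Type*) [AddCommGroup N] [Module A N]

/-- The subgroup of `M ⊗[ℤ] N` generated by all `(m a) ⊗ n - m ⊗ (a n)`. A right `A`-module
is a module over `Aᵐᵒᵖ`, so that `m a` is `op a • m`. -/
def balancedRelations : AddSubgroup (M ⊗[ℤ] N) :=
  AddSubgroup.closure
    {x | ∃ (m : M) (a : A) (n : N), x = (op a • m) ⊗ₜ[ℤ] n - m ⊗ₜ[ℤ] (a • n)}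

/-- The tensor product over a (possibly noncommutative) ring `A` of a right `A`-module `M` and a
left `A`-module `N`. It is an abelian group. -/
abbrev BalancedTensor : Type _ := (M ⊗[ℤ] N) ⧸ balancedRelations A M N

variable {M} {M' : Type*} [AddCommGroup M'] [Module Aᵐᵒᵖ M']

/-- The homomorphism `f ⊗ id : M ⊗_A N → M' ⊗_A N` induced by a map `f` of right `A`-modules. -/
def BalancedTensor.map (f : M →ₗ[Aᵐᵒᵖ] M') : BalancedTensor A M N →+ BalancedTensor A M' N :=
  QuotientAddGroup.map _ _
    (TensorProduct.map f.toAddMonoidHom.toIntLinearMap LinearMap.id).toAddMonoidHom (by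
    rw [balancedRelations, AddSubgroup.closure_le]
    rintro _ ⟨m, a, n, rfl⟩
    refine AddSubgroup.subset_closure ⟨f m, a, n, ?_⟩
    rw [map_sub, ← map_smul]
    rfl)

variable {A N} in
/-- Two homomorphisms on the balanced tensor product agree if they agree on pure tensors. -/
lemma BalancedTensor.hom_ext {P : Type*} [AddCommGroup P] {f g : BalancedTensor A M N →+ P}
    (h : ∀ (m : M) (n : N), f (QuotientAddGroup.mk (m ⊗ₜ[ℤ] n)) =
      g (QuotientAddGroup.mk (m ⊗ₜ[ℤ] n))) : f = g := by
  refine QuotientAddGroup.addMonoidHom_ext _ (DFunLike.ext _ _ fun x => ?_)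
  induction x using TensorProduct.induction_on with
  | zero => rw [map_zero, map_zero]
  | tmul m n => exact h m n
  | add x y hx hy => rw [map_add, map_add, hx, hy]

/-- The functor `- ⊗_A N` from right `A`-modules to abelian groups. -/
def balancedTensorFunctor (A N : Type u) [Ring A] [AddCommGroup N] [Module A N] :
    ModuleCat.{u} Aᵐᵒᵖ ⥤ AddCommGrpCat.{u} where
  obj M := AddCommGrpCat.of (BalancedTensor A M N)
  map f := AddCommGrpCat.ofHom (BalancedTensor.map A N f.hom)
  map_id _ := AddCommGrpCat.hom_ext (BalancedTensor.hom_ext fun _ _ => rfl)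
  map_comp _ _ := AddCommGrpCat.hom_ext (BalancedTensor.hom_ext fun _ _ => rfl)

instance (A N : Type u) [Ring A] [AddCommGroup N] [Module A N] :
    (balancedTensorFunctor A N).Additive where
  map_add {_ _ f g} := AddCommGrpCat.hom_ext (BalancedTensor.hom_ext fun m n =>
    congrArg QuotientAddGroup.mk (TensorProduct.add_tmul (f.hom m) (g.hom m) n))

/-- A left module `N` over a (possibly noncommutative) ring `A` is flat: tensoring with `N`
preserves injectivity of maps of right `A`-modules. -/
def IsFlat (A N : Type u) [Ring A] [AddCommGroup N] [Module A N] : Prop :=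
  ∀ (M M' : Type u) [AddCommGroup M] [AddCommGroup M'] [Module Aᵐᵒᵖ M] [Module Aᵐᵒᵖ M']
    (f : M →ₗ[Aᵐᵒᵖ] M'), Function.Injective f → Function.Injective (BalancedTensor.map A N f)

end Tensor

/-! ### The universal covering space, with the right action of the fundamental group -/

section UniversalCover

variable {X : Type u} [TopologicalSpace X]

/-- The underlying set of the universal covering space of `X` at `x₀`: the homotopy classes, with
fixed end points, of paths that start at `x₀`. -/
def UniversalCover (x₀ : X) : Type u := Σ x : X, Path.Homotopic.Quotient x₀ x

/-- The space of all paths in `X` that start at `x₀`, with the compact-open topology. -/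
abbrev BasedPaths (x₀ : X) : Type u := {c : C(I, X) // c 0 = x₀}

/-- A based path as a path from `x₀` to its end point. -/
def BasedPaths.toPath {x₀ : X} (c : BasedPaths x₀) : Path x₀ (c.1 1) where
  toContinuousMap := c.1
  source' := c.2
  target' := rfl

/-- The map that takes a based path to its homotopy class. -/
def UniversalCover.mk {x₀ : X} (c : BasedPaths x₀) : UniversalCover x₀ :=
  ⟨c.1 1, Path.Homotopic.Quotient.mk c.toPath⟩

/-- The universal covering space has the quotient topology of the space of based paths. (For
spaces that have a universal covering, such as connected CW complexes, this is the usual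
topology.) -/
instance (x₀ : X) : TopologicalSpace (UniversalCover x₀) :=
  TopologicalSpace.coinduced UniversalCover.mk inferInstance

/-- The covering projection: the end point of a path. -/
def UniversalCover.proj (x₀ : X) : UniversalCover x₀ → X := Sigma.fst

/-- The right action of the fundamental group on the universal covering space by deck
transformations, `[c] · γ = [γ followed by c]`. In Mathlib's fundamental group, `γ * δ` is `δ`
followed by `γ`, so this is a right action. -/
def UniversalCover.deck {x₀ : X} (γ : FundamentalGroup X x₀) (e : UniversalCover x₀) :
    UniversalCover x₀ :=
  ⟨e.1, Path.Homotopic.Quotient.trans γ.toPath e.2⟩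

lemma UniversalCover.mk_surjective (x₀ : X) :
    Function.Surjective (UniversalCover.mk : BasedPaths x₀ → UniversalCover x₀) := by
  rintro ⟨x, a⟩
  induction a using Path.Homotopic.Quotient.ind with
  | mk p =>
    obtain ⟨p, h0, rfl⟩ := p
    exact ⟨⟨p, h0⟩, rfl⟩

lemma UniversalCover.continuous_deck {x₀ : X} (γ : FundamentalGroup X x₀) :
    Continuous (UniversalCover.deck γ) := by
  rw [continuous_coinduced_dom]
  obtain ⟨l, hl⟩ : ∃ l : Path x₀ x₀, Path.Homotopic.Quotient.mk l = γ.toPath := by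
    induction h : γ.toPath using Path.Homotopic.Quotient.ind with
    | mk l => exact ⟨l, rfl⟩
  have hc : Continuous (fun c : BasedPaths x₀ =>
      (l.trans c.toPath : Path x₀ (c.1 1)).toContinuousMap) := by
    apply ContinuousMap.continuous_of_continuous_uncurry
    refine Path.trans_continuous_family (fun _ : BasedPaths x₀ => l) ?_
      (fun c : BasedPaths x₀ => c.toPath) ?_
    · exact l.continuous.comp continuous_snd
    · change Continuous (fun q : BasedPaths x₀ × I => q.1.1 q.2)
      fun_prop
  have hq : Continuous (fun c : BasedPaths x₀ =>
      UniversalCover.mk (⟨(l.trans c.toPath).toContinuousMap, (l.trans c.toPath).source⟩ :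
        BasedPaths x₀)) :=
    Continuous.comp (g := UniversalCover.mk) continuous_coinduced_rng (hc.subtype_mk _)
  convert hq using 1
  funext c
  have key : ∀ (y z : X) (h : z = y) (p : Path x₀ y) (q : Path x₀ z), (∀ t, p t = q t) →
      (⟨y, Path.Homotopic.Quotient.mk p⟩ : UniversalCover x₀) =
        ⟨z, Path.Homotopic.Quotient.mk q⟩ := by
    rintro y z rfl p q h
    have : p = q := Path.ext (funext h)
    rw [this]
  change (⟨c.1 1, Path.Homotopic.Quotient.trans γ.toPath (Path.Homotopic.Quotient.mk c.toPath)⟩ :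
    UniversalCover x₀) = _
  rw [← hl, ← Path.Homotopic.Quotient.mk_trans]
  exact key _ _ (l.trans c.toPath).target _ _ (fun _ => rfl)

lemma UniversalCover.deck_one {x₀ : X} (e : UniversalCover x₀) : UniversalCover.deck 1 e = e := by
  obtain ⟨x, a⟩ := e
  exact congrArg (Sigma.mk x) (Category.id_comp (X := FundamentalGroupoid.mk x₀)
    (Y := FundamentalGroupoid.mk x) a)

lemma UniversalCover.deck_mul {x₀ : X} (γ δ : FundamentalGroup X x₀) (e : UniversalCover x₀) :
    UniversalCover.deck (γ * δ) e = UniversalCover.deck δ (UniversalCover.deck γ e) := by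
  obtain ⟨x, a⟩ := e
  exact congrArg (Sigma.mk x) (Category.assoc (W := FundamentalGroupoid.mk x₀)
    (Z := FundamentalGroupoid.mk x) δ γ a)

end UniversalCover

/-! ### Homology with coefficients in a module over the integral group ring -/

section Homology

variable {X : Type u} [TopologicalSpace X] (x₀ : X)

/-- The singular simplicial set of the universal covering space. -/
def singularUC : SSet.{u} := TopCat.toSSet.obj (TopCat.of (UniversalCover x₀))

/-- The deck transformation of `γ` on singular simplices. -/
def singularDeck (γ : FundamentalGroup X x₀) : singularUC x₀ ⟶ singularUC x₀ :=
  TopCat.toSSet.map (TopCat.ofHom ⟨UniversalCover.deck γ, UniversalCover.continuous_deck γ⟩)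

lemma singularDeck_one : singularDeck x₀ 1 = 𝟙 _ := by
  refine Eq.trans (congrArg TopCat.toSSet.map ?_) (TopCat.toSSet.map_id _)
  ext e
  exact UniversalCover.deck_one e

lemma singularDeck_mul (γ δ : FundamentalGroup X x₀) :
    singularDeck x₀ (γ * δ) = singularDeck x₀ γ ≫ singularDeck x₀ δ := by
  refine Eq.trans (congrArg TopCat.toSSet.map ?_) (TopCat.toSSet.map_comp _ _)
  ext e
  exact UniversalCover.deck_mul γ δ e

/-- The group of singular `n`-chains of the universal covering space. -/
abbrev SingularChains (n : SimplexCategoryᵒᵖ) : Type u := (singularUC x₀).obj n →₀ ℤ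

/-- The right action of the fundamental group on singular chains, `σ ↦ σ · γ`. -/
def chainDeck (n : SimplexCategoryᵒᵖ) :
    FundamentalGroup X x₀ →* (Module.End ℤ (SingularChains x₀ n))ᵐᵒᵖ where
  toFun γ := op (Finsupp.lmapDomain ℤ ℤ ((singularDeck x₀ γ).app n))
  map_one' := by
    rw [singularDeck_one]
    exact congrArg op (Finsupp.lmapDomain_id ℤ ℤ)
  map_mul' γ δ := by
    rw [singularDeck_mul]
    exact congrArg op (Finsupp.lmapDomain_comp ℤ ℤ ((singularDeck x₀ γ).app n)
      ((singularDeck x₀ δ).app n))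

/-- The singular chains as a right module over the integral group ring `ℤ[π₁(X, x₀)]`. -/
instance (n : SimplexCategoryᵒᵖ) :
    Module (MonoidAlgebra ℤ (FundamentalGroup X x₀))ᵐᵒᵖ (SingularChains x₀ n) :=
  Module.compHom (SingularChains x₀ n)
    ((RingEquiv.opOp (Module.End ℤ (SingularChains x₀ n))).symm.toRingHom.comp
      (RingHom.op (MonoidAlgebra.lift ℤ _ _ (chainDeck x₀ n)).toRingHom))

lemma op_smul_def (n : SimplexCategoryᵒᵖ) (a : MonoidAlgebra ℤ (FundamentalGroup X x₀))
    (c : SingularChains x₀ n) :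
    op a • c = (MonoidAlgebra.lift ℤ _ _ (chainDeck x₀ n) a).unop c := rfl

/-- A map of the simplex category acts on singular chains. -/
def chainMap {m n : SimplexCategoryᵒᵖ} (f : m ⟶ n) :
    SingularChains x₀ m →ₗ[(MonoidAlgebra ℤ (FundamentalGroup X x₀))ᵐᵒᵖ] SingularChains x₀ n where
  toFun := Finsupp.lmapDomain ℤ ℤ ((singularUC x₀).map f)
  map_add' := map_add _
  map_smul' := by
    intro a c
    obtain ⟨a, rfl⟩ := op_surjective a
    rw [RingHom.id_apply, op_smul_def, op_smul_def]
    induction a using MonoidAlgebra.induction_linear with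
    | zero => simp
    | add a b ha hb =>
      rw [map_add, map_add]
      exact (map_add _ _ _).trans (congrArg₂ (· + ·) ha hb)
    | single γ k =>
      simp only [MonoidAlgebra.lift_single, unop_smul, LinearMap.smul_apply, map_smul]
      congr 1
      change Finsupp.mapDomain _ (Finsupp.mapDomain _ c) =
        Finsupp.mapDomain _ (Finsupp.mapDomain _ c)
      rw [← Finsupp.mapDomain_comp, ← Finsupp.mapDomain_comp]
      refine congrArg (fun h => Finsupp.mapDomain h c) (funext fun s => ?_)
      exact (ConcreteCategory.congr_hom ((singularDeck x₀ γ).naturality f) s).symm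

/-- The simplicial right `ℤ[π₁(X, x₀)]`-module of singular chains of the universal covering. -/
def simplicialChains :
    SimplicialObject (ModuleCat.{u} (MonoidAlgebra ℤ (FundamentalGroup X x₀))ᵐᵒᵖ) where
  obj n := ModuleCat.of _ (SingularChains x₀ n)
  map f := ModuleCat.ofHom (chainMap x₀ f)
  map_id n := by
    refine ModuleCat.hom_ext (LinearMap.ext fun c => ?_)
    change Finsupp.lmapDomain ℤ ℤ ((singularUC x₀).map (𝟙 n)) c = c
    rw [(singularUC x₀).map_id]
    exact LinearMap.congr_fun (Finsupp.lmapDomain_id ℤ ℤ) c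
  map_comp f g := by
    refine ModuleCat.hom_ext (LinearMap.ext fun c => ?_)
    change Finsupp.lmapDomain ℤ ℤ ((singularUC x₀).map (f ≫ g)) c =
      Finsupp.lmapDomain ℤ ℤ ((singularUC x₀).map g)
        (Finsupp.lmapDomain ℤ ℤ ((singularUC x₀).map f) c)
    rw [(singularUC x₀).map_comp]
    exact LinearMap.congr_fun (Finsupp.lmapDomain_comp ℤ ℤ ((singularUC x₀).map f)
      ((singularUC x₀).map g)) c

/-- The singular chain complex of the universal covering space of `X`, as a complex of right
`ℤ[π₁(X, x₀)]`-modules; its differential is the alternating sum of the faces. -/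
def chainsUC :
    ChainComplex (ModuleCat.{u} (MonoidAlgebra ℤ (FundamentalGroup X x₀))ᵐᵒᵖ) ℕ :=
  (AlgebraicTopology.alternatingFaceMapComplex _).obj (simplicialChains x₀)

variable (M : Type u) [AddCommGroup M] [Module (MonoidAlgebra ℤ (FundamentalGroup X x₀)) M]

/-- The complex `C_*(X̃) ⊗_{ℤ[π₁(X, x₀)]} M`. -/
def chainsWithCoeff : ChainComplex AddCommGrpCat.{u} ℕ :=
  ((balancedTensorFunctor (MonoidAlgebra ℤ (FundamentalGroup X x₀)) M).mapHomologicalComplex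
    _).obj (chainsUC x₀)

/-- The homology group `H_i(X; M) = H_i(C_*(X̃) ⊗_{ℤ[π₁(X, x₀)]} M)` of `X` with coefficients
in a left `ℤ[π₁(X, x₀)]`-module `M`. -/
def Homology (i : ℕ) : AddCommGrpCat.{u} := (chainsWithCoeff x₀ M).homology i

/-- `H_i(X; M) = 0` for all `0 ≤ i ≤ n`. -/
def HomologyVanishesUpTo (n : ℕ) : Prop :=
  ∀ i ≤ n, Subsingleton (Homology x₀ M i)

end Homology

/-! ### The reduced group `C*`-algebras -/

section CStar

variable (G : Type u) [Group G]

/-- The Hilbert space `l²(G)` of square summable complex functions on `G`. -/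
abbrev L2 : Type u := lp (fun _ : G => ℂ) 2

variable {G}

lemma memℓp_translate (g : G) (f : L2 G) : Memℓp (fun x => f (g⁻¹ * x)) 2 := by
  have h := lp.memℓp f
  rw [memℓp_gen_iff (by norm_num)] at h ⊢
  exact (Equiv.mulLeft g⁻¹).summable_iff.mpr h

/-- The left translation `(g f)(x) = f(g⁻¹ x)` on `l²(G)`. -/
def translate (g : G) : L2 G →L[ℂ] L2 G :=
  LinearMap.mkContinuous
    { toFun := fun f => ⟨fun x => f (g⁻¹ * x), memℓp_translate g f⟩
      map_add' := fun _ _ => rfl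
      map_smul' := fun _ _ => rfl } 1 (by
    intro f
    rw [one_mul]
    apply le_of_eq
    have h2 : 0 < (2 : ENNReal).toReal := by norm_num
    rw [lp.norm_eq_tsum_rpow h2, lp.norm_eq_tsum_rpow h2]
    congr 1
    exact (Equiv.mulLeft g⁻¹).tsum_eq (fun x => ‖f x‖ ^ (2 : ENNReal).toReal))

lemma translate_apply (g : G) (f : L2 G) (x : G) : translate g f x = f (g⁻¹ * x) := rfl

variable (G)

/-- The left regular representation of `G` on `l²(G)`. -/
def leftRegular : G →* (L2 G →L[ℂ] L2 G) where
  toFun := translate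
  map_one' := by
    ext f x
    simp [translate_apply]
  map_mul' g h := by
    ext f x
    simp [translate_apply, mul_assoc]

/-- The reduced group `C*`-algebra `C*_r(G)`: the closure of the image of `ℂ[G]` in the bounded
operators on `l²(G)`, for the operator norm. -/
def complexReduced : Subalgebra ℂ (L2 G →L[ℂ] L2 G) :=
  (MonoidAlgebra.lift ℂ _ _ (leftRegular G)).range.topologicalClosure

/-- The real reduced group `C*`-algebra `C*_ℝ(G)`: the closure of the image of `ℝ[G]` in the
bounded operators on `l²(G)`, for the operator norm. -/
def realReduced : Subalgebra ℝ (L2 G →L[ℂ] L2 G) :=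
  (MonoidAlgebra.lift ℝ _ _ (leftRegular G)).range.topologicalClosure

/-- The canonical map `G → C*_r(G)`. -/
def toComplexReduced : G →* complexReduced G :=
  (leftRegular G).codRestrict (complexReduced G) fun g =>
    Subalgebra.le_topologicalClosure _ ⟨MonoidAlgebra.of ℂ G g, MonoidAlgebra.lift_of _ _⟩

/-- The canonical map `G → C*_ℝ(G)`. -/
def toRealReduced : G →* realReduced G :=
  (leftRegular G).codRestrict (realReduced G) fun g =>
    Subalgebra.le_topologicalClosure _ ⟨MonoidAlgebra.of ℝ G g, MonoidAlgebra.lift_of _ _⟩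

/-- `C*_r(G)` as a left `ℤ[G]`-module, through the canonical ring homomorphism
`ℤ[G] → C*_r(G)`. -/
instance : Module (MonoidAlgebra ℤ G) (complexReduced G) :=
  Module.compHom _ (MonoidAlgebra.lift ℤ _ _ (toComplexReduced G)).toRingHom

/-- `C*_ℝ(G)` as a left `ℤ[G]`-module, through the canonical ring homomorphism
`ℤ[G] → C*_ℝ(G)`. -/
instance : Module (MonoidAlgebra ℤ G) (realReduced G) :=
  Module.compHom _ (MonoidAlgebra.lift ℤ _ _ (toRealReduced G)).toRingHom

end CStar

end FlatCoeff

end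

/-!
The topology of `X` plays no role: the equivalence holds in each degree separately and for the
homology of `C ⊗_A -`, where `A = ℤ[π₁(X, x₀)]` and `C` is any complex of right `A`-modules.

Since `R'` is an `A`-`R'`-bimodule, `C ⊗_A R'` is a complex of right `R'`-modules, and
`(C ⊗_A R') ⊗_{R'} R = C ⊗_A R` (`BalancedTensor.cancelBaseChange`). It remains to see that
`- ⊗_{R'} R` preserves and reflects exactness of complexes `M₁ → M₂ → M₃` of right `R'`-modules
(`exact_map_iff`). As `R / R'` is flat, `Tor₁(M, R / R') = 0` for every right module `M`, so that
`M = M ⊗ R' → M ⊗ R` is injective (`tmul_map_one_injective`). Consequently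

* `R` is flat (`isFlat_of_isFlat_quotient`), so tensoring with it preserves exactness;
* if a cycle `x` of `M₂` becomes a boundary in `M₂ ⊗ R`, then its class in `coker (M₁ → M₂)`
  becomes zero in `coker (M₁ → M₂) ⊗ R`, hence is zero, and `x` is a boundary.

For the group `C*`-algebras, conjugating operators on `l²(G)` by complex conjugation of functions
splits them into real and imaginary parts. The imaginary part is a map
`C*_r(G) → C*_ℝ(G)` of left `C*_ℝ(G)`-modules, which is surjective with kernel `C*_ℝ(G)`. Therefore
`C*_r(G) / C*_ℝ(G)` is free of rank one, in particular flat.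
-/

noncomputable section

namespace FlatCoeff

namespace BalancedTensor

/-! ### Balanced tensor products: universal property and right exactness -/

section Basic

variable {A : Type*} [Ring A] {M : Type*} [AddCommGroup M] [Module Aᵐᵒᵖ M]
  {M' : Type*} [AddCommGroup M'] [Module Aᵐᵒᵖ M']
  {N : Type*} [AddCommGroup N] [Module A N] {N' : Type*} [AddCommGroup N'] [Module A N']
  {N'' : Type*} [AddCommGroup N''] [Module A N'']
  {P : Type*} [AddCommGroup P]

variable (A M N) in
/-- The universal balanced biadditive map `(m, n) ↦ m ⊗ n`. -/
def tmul : M →+ N →+ BalancedTensor A M N :=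
  AddMonoidHom.mk' (fun m => AddMonoidHom.mk' (fun n => QuotientAddGroup.mk (m ⊗ₜ[ℤ] n))
    fun n n' => congrArg QuotientAddGroup.mk (TensorProduct.tmul_add m n n'))
    fun m m' => AddMonoidHom.ext fun n =>
      congrArg QuotientAddGroup.mk (TensorProduct.add_tmul m m' n)

lemma smul_tmul (m : M) (a : A) (n : N) :
    tmul A M N (op a • m) n = tmul A M N m (a • n) :=
  (QuotientAddGroup.eq_iff_sub_mem).mpr (AddSubgroup.subset_closure ⟨m, a, n, rfl⟩)

/-- The homomorphism on `M ⊗_A N` induced by a balanced biadditive map. -/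
def lift (φ : M →+ N →+ P) (h : ∀ (m : M) (a : A) (n : N), φ (op a • m) n = φ m (a • n)) :
    BalancedTensor A M N →+ P :=
  QuotientAddGroup.lift _
    (TensorProduct.liftAddHom φ fun r m n => by simp) (by
    rw [balancedRelations, AddSubgroup.closure_le]
    rintro _ ⟨m, a, n, rfl⟩
    rw [SetLike.mem_coe, AddMonoidHom.mem_ker, map_sub, TensorProduct.liftAddHom_tmul,
      TensorProduct.liftAddHom_tmul, h, sub_self])

@[simp]
lemma lift_tmul (φ : M →+ N →+ P)
    (h : ∀ (m : M) (a : A) (n : N), φ (op a • m) n = φ m (a • n)) (m : M) (n : N) :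
    lift φ h (tmul A M N m n) = φ m n := rfl

@[simp]
lemma map_tmul (f : M →ₗ[Aᵐᵒᵖ] M') (m : M) (n : N) :
    map A N f (tmul A M N m n) = tmul A M' N (f m) n := rfl

lemma hom_ext_tmul {f g : BalancedTensor A M N →+ P}
    (h : ∀ m n, f (tmul A M N m n) = g (tmul A M N m n)) : f = g :=
  hom_ext h

lemma induction_on {p : BalancedTensor A M N → Prop} (x : BalancedTensor A M N)
    (tmul : ∀ m n, p (tmul A M N m n)) (add : ∀ x y, p x → p y → p (x + y)) : p x := by
  obtain ⟨x, rfl⟩ := QuotientAddGroup.mk_surjective x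
  induction x using TensorProduct.induction_on with
  | zero => simpa using tmul 0 0
  | tmul m n => exact tmul m n
  | add x y hx hy => exact add _ _ hx hy

lemma map_map {M'' : Type*} [AddCommGroup M''] [Module Aᵐᵒᵖ M''] (f : M →ₗ[Aᵐᵒᵖ] M')
    (g : M' →ₗ[Aᵐᵒᵖ] M'') (x : BalancedTensor A M N) :
    map A N g (map A N f x) = map A N (g ∘ₗ f) x :=
  DFunLike.congr_fun (f := (map A N g).comp (map A N f)) (g := map A N (g ∘ₗ f))
    (hom_ext_tmul fun _ _ => rfl) x

variable (M) in
/-- The homomorphism `id ⊗ g : M ⊗_A N → M ⊗_A N'` induced by a map `g` of left modules. -/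
def lTensor (g : N →ₗ[A] N') : BalancedTensor A M N →+ BalancedTensor A M N' :=
  lift ((AddMonoidHom.compHom.flip g.toAddMonoidHom).comp (tmul A M N')) fun m a n => by
    change tmul A M N' (op a • m) (g n) = tmul A M N' m (g (a • n))
    rw [smul_tmul, g.map_smul]

@[simp]
lemma lTensor_tmul (g : N →ₗ[A] N') (m : M) (n : N) :
    lTensor M g (tmul A M N m n) = tmul A M N' m (g n) := rfl

lemma lTensor_lTensor (g : N →ₗ[A] N') (h : N' →ₗ[A] N'') (x : BalancedTensor A M N) :
    lTensor M h (lTensor M g x) = lTensor M (h ∘ₗ g) x :=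
  DFunLike.congr_fun (f := (lTensor M h).comp (lTensor M g))
    (g := lTensor M (h ∘ₗ g)) (hom_ext_tmul fun _ _ => rfl) x

lemma lTensor_id (x : BalancedTensor A M N) : lTensor M (LinearMap.id : N →ₗ[A] N) x = x :=
  DFunLike.congr_fun (f := lTensor M LinearMap.id) (g := AddMonoidHom.id _)
    (hom_ext_tmul fun _ _ => rfl) x

lemma lTensor_map (f : M →ₗ[Aᵐᵒᵖ] M') (g : N →ₗ[A] N') (x : BalancedTensor A M N) :
    lTensor M' g (map A N f x) = map A N' f (lTensor M g x) :=
  DFunLike.congr_fun (f := (lTensor M' g).comp (map A N f))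
    (g := (map A N' f).comp (lTensor M g)) (hom_ext_tmul fun _ _ => rfl) x

/-- Right exactness in the first variable: if `M → M' → M'' → 0` is exact, then the kernel of
`M' ⊗ N → M'' ⊗ N` is contained in the image of `M ⊗ N`. -/
lemma exists_map_eq {M'' : Type*} [AddCommGroup M''] [Module Aᵐᵒᵖ M''] {f : M →ₗ[Aᵐᵒᵖ] M'}
    {g : M' →ₗ[Aᵐᵒᵖ] M''} (hfg : Function.Exact f g) (hg : Function.Surjective g)
    (x : BalancedTensor A M' N) (hx : map A N g x = 0) : ∃ y, map A N f y = x := by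
  -- The projection onto the cokernel of `f ⊗ id` factors through `M'' ⊗ N`.
  let π := QuotientAddGroup.mk' (map A N f).range
  let φ : M' →+ N →+ BalancedTensor A M' N ⧸ (map A N f).range :=
    (AddMonoidHom.compHom π).comp (tmul A M' N)
  let q := g.toAddMonoidHom
  have hker : q.ker ≤ φ.ker := by
    intro m hm
    obtain ⟨m, rfl⟩ := (hfg m).mp hm
    ext n
    exact (QuotientAddGroup.eq_zero_iff _).mpr ⟨tmul A M N m n, rfl⟩
  let ψ := AddMonoidHom.liftOfSurjective q hg ⟨φ, hker⟩
  have hψ (m : M') : ψ (q m) = φ m :=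
    AddMonoidHom.liftOfRightInverse_comp_apply q _ _ ⟨φ, hker⟩ m
  have hbal (m : M'') (a : A) (n : N) : ψ (op a • m) n = ψ m (a • n) := by
    obtain ⟨m, rfl⟩ := hg m
    have : op a • g m = q (op a • m) := (map_smul g (op a) m).symm
    rw [this, show g m = q m from rfl, hψ, hψ]
    exact congrArg π (smul_tmul m a n)
  have hfac : (lift ψ hbal).comp (map A N g) = π :=
    hom_ext_tmul fun m n => DFunLike.congr_fun (hψ m) n
  have : π x = 0 := by
    rw [← hfac, AddMonoidHom.comp_apply, hx, map_zero]
  exact (QuotientAddGroup.eq_zero_iff x).mp this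

/-- Right exactness in the second variable, for the cokernel of a map out of `A`, where
`M ⊗_A A` consists of the elements `m ⊗ 1`. -/
lemma exists_tmul_eq (ι : A →ₗ[A] N) (x : BalancedTensor A M N)
    (hx : lTensor M (LinearMap.range ι).mkQ x = 0) : ∃ m, tmul A M N m (ι 1) = x := by
  let S := ((tmul A M N).flip (ι 1)).range
  let π := QuotientAddGroup.mk' S
  let φ : N →+ M →+ BalancedTensor A M N ⧸ S := ((AddMonoidHom.compHom π).comp (tmul A M N)).flip
  let q := (LinearMap.range ι).mkQ.toAddMonoidHom
  have hq : Function.Surjective q := Submodule.mkQ_surjective _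
  have hker : q.ker ≤ φ.ker := by
    intro n hn
    obtain ⟨a, rfl⟩ := (Submodule.Quotient.mk_eq_zero _).mp hn
    ext m
    refine (QuotientAddGroup.eq_zero_iff _).mpr ⟨op a • m, ?_⟩
    rw [AddMonoidHom.flip_apply, smul_tmul, ← map_smul, smul_eq_mul, mul_one]
  let ψ := AddMonoidHom.liftOfSurjective q hq ⟨φ, hker⟩
  have hψ (n : N) : ψ (q n) = φ n :=
    AddMonoidHom.liftOfRightInverse_comp_apply q _ _ ⟨φ, hker⟩ n
  have hbal (m : M) (a : A) (n : N ⧸ LinearMap.range ι) :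
      ψ.flip (op a • m) n = ψ.flip m (a • n) := by
    obtain ⟨n, rfl⟩ := hq n
    have : a • q n = q (a • n) := rfl
    rw [this, AddMonoidHom.flip_apply, AddMonoidHom.flip_apply, hψ, hψ]
    exact congrArg π (smul_tmul m a n)
  have hfac : (lift ψ.flip hbal).comp (lTensor M (LinearMap.range ι).mkQ) = π :=
    hom_ext_tmul fun m n => DFunLike.congr_fun (hψ n) m
  have : π x = 0 := by
    rw [← hfac, AddMonoidHom.comp_apply, hx, map_zero]
  exact (QuotientAddGroup.eq_zero_iff x).mp this

variable (M) in
/-- The isomorphism `M ⊗_A A ≃ M`. -/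
def rid : BalancedTensor A M A ≃+ M where
  toFun := lift (AddMonoidHom.mk' (fun m => AddMonoidHom.mk' (fun a => op a • m)
      fun a b => add_smul (op a) (op b) m)
      fun m m' => AddMonoidHom.ext fun a => smul_add (op a) m m') fun m a b => by
    change op b • op a • m = op (a * b) • m
    rw [smul_smul, op_mul]
  invFun m := tmul A M A m 1
  map_add' := map_add _
  left_inv x := by
    induction x using induction_on with
    | tmul m a =>
      change tmul A M A (op a • m) 1 = _
      rw [smul_tmul, smul_eq_mul, mul_one]
    | add x y hx hy =>
      refine Eq.trans ?_ (congrArg₂ (· + ·) hx hy)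
      change (tmul A M A).flip 1 _ = (tmul A M A).flip 1 _ + (tmul A M A).flip 1 _
      rw [map_add, map_add]
  right_inv m := by
    change op (1 : A) • m = m
    rw [op_one, one_smul]

lemma rid_map (f : M →ₗ[Aᵐᵒᵖ] M') (x : BalancedTensor A M A) :
    rid M' (map A A f x) = f (rid M x) := by
  induction x using induction_on with
  | tmul m a => exact (map_smul f (op a) m).symm
  | add x y hx hy => rw [map_add, map_add, map_add, map_add, hx, hy]

end Basic

end BalancedTensor

/-! ### Flat modules and pure extensions of the base ring -/

section Flat

open BalancedTensor

variable {A : Type u} [Ring A]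

lemma isFlat_self : IsFlat A A := by
  intro M M' _ _ _ _ f hf x y hxy
  apply (rid M).injective
  apply hf
  rw [← rid_map, ← rid_map, hxy]

lemma IsFlat.of_linearEquiv {N N' : Type u} [AddCommGroup N] [Module A N] [AddCommGroup N']
    [Module A N'] (e : N ≃ₗ[A] N') (h : IsFlat A N) : IsFlat A N' := by
  intro M M' _ _ _ _ f hf x y hxy
  have : lTensor M e.symm.toLinearMap x = lTensor M e.symm.toLinearMap y := by
    apply h M M' f hf
    rw [← lTensor_map, ← lTensor_map, hxy]
  simpa [lTensor_lTensor, lTensor_id] using congrArg (lTensor M e.toLinearMap) this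

variable {N : Type u} [AddCommGroup N] [Module A N] {ι : A →ₗ[A] N}

/-- For an injective map `ι : A → N` and a free right module `F`, the map `F → F ⊗ N` induced by
`ι` is injective, because it is so on each coordinate. -/
lemma eq_zero_of_tmul_map_one_eq_zero_finsupp (hι : Function.Injective ι) {S : Type u}
    (z : S →₀ Aᵐᵒᵖ) (hz : tmul A (S →₀ Aᵐᵒᵖ) N z (ι 1) = 0) : z = 0 := by
  let μ : BalancedTensor A Aᵐᵒᵖ N →+ N :=
    lift (AddMonoidHom.mk' (fun b => AddMonoidHom.mk' (fun n => b.unop • n)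
      fun n n' => smul_add b.unop n n')
      fun b b' => AddMonoidHom.ext fun n => add_smul b.unop b'.unop n) fun b a n =>
        mul_smul b.unop a n
  ext i
  have h := congrArg (fun t => μ (map A N (Finsupp.lapply (R := Aᵐᵒᵖ) i) t)) hz
  have h' : (z i).unop • ι 1 = 0 := h.trans (by simp)
  rw [← map_smul, smul_eq_mul, mul_one] at h'
  exact unop_injective (hι (h'.trans (map_zero ι).symm))

/-- Injectivity of `F → F ⊗ N` passes to a quotient `M` of `F` if the cokernel of `ι` is flat. This
is the diagram chase showing that the kernel of `M → M ⊗ N` is a quotient of `Tor₁(M, coker ι)`. -/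
lemma eq_zero_of_tmul_map_one_eq_zero_of_surjective (hflat : IsFlat A (N ⧸ LinearMap.range ι))
    {F M : Type u} [AddCommGroup F] [Module Aᵐᵒᵖ F] [AddCommGroup M] [Module Aᵐᵒᵖ M]
    (p : F →ₗ[Aᵐᵒᵖ] M) (hp : Function.Surjective p)
    (hF : ∀ z : F, tmul A F N z (ι 1) = 0 → z = 0) (m : M) (hm : tmul A M N m (ι 1) = 0) :
    m = 0 := by
  obtain ⟨e, rfl⟩ := hp m
  obtain ⟨y, hy⟩ : ∃ y, map A N (LinearMap.ker p).subtype y = tmul A F N e (ι 1) :=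
    exists_map_eq p.exact_subtype_ker_map hp _ hm
  obtain ⟨k, rfl⟩ : ∃ k, tmul A (LinearMap.ker p) N k (ι 1) = y := by
    apply exists_tmul_eq
    apply hflat _ F (LinearMap.ker p).subtype (LinearMap.ker p).subtype_injective
    have : (LinearMap.range ι).mkQ (ι 1) = 0 :=
      (Submodule.Quotient.mk_eq_zero _).mpr ⟨1, rfl⟩
    rw [← lTensor_map, hy, lTensor_tmul, this, map_zero, map_zero]
  have hek : e - k = 0 := by
    apply hF
    rw [map_sub, AddMonoidHom.sub_apply, ← hy, map_tmul]
    exact sub_self _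
  rw [sub_eq_zero.mp hek]
  exact k.2

/-- If `ι : A → N` is injective with flat cokernel, it is pure: it remains injective after
tensoring with any right module. -/
lemma tmul_map_one_injective (hι : Function.Injective ι)
    (hflat : IsFlat A (N ⧸ LinearMap.range ι)) (M : Type u) [AddCommGroup M] [Module Aᵐᵒᵖ M] :
    Function.Injective fun m : M => tmul A M N m (ι 1) :=
  (injective_iff_map_eq_zero ((tmul A M N).flip (ι 1))).mpr
    (eq_zero_of_tmul_map_one_eq_zero_of_surjective hflat (Finsupp.linearCombination Aᵐᵒᵖ id)
      (Finsupp.linearCombination_id_surjective _ _)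
      (eq_zero_of_tmul_map_one_eq_zero_finsupp hι))

/-- An extension of a flat module by the base ring is flat. -/
lemma isFlat_of_isFlat_quotient (hι : Function.Injective ι)
    (hflat : IsFlat A (N ⧸ LinearMap.range ι)) : IsFlat A N := by
  intro M M' _ _ _ _ f hf
  rw [injective_iff_map_eq_zero]
  intro x hx
  obtain ⟨m, rfl⟩ : ∃ m, tmul A M N m (ι 1) = x := by
    apply exists_tmul_eq
    apply hflat M M' f hf
    rw [← lTensor_map, hx, map_zero, map_zero]
  have hfm : f m = 0 := tmul_map_one_injective hι hflat M' (hx.trans (by simp))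
  rw [hf (hfm.trans (map_zero f).symm), map_zero, AddMonoidHom.zero_apply]

/-- Tensoring with `N` both preserves and reflects exactness if `A` embeds into `N` with flat
cokernel. -/
lemma exact_map_iff (hι : Function.Injective ι) (hflat : IsFlat A (N ⧸ LinearMap.range ι))
    {M₁ M₂ M₃ : Type u} [AddCommGroup M₁] [AddCommGroup M₂] [AddCommGroup M₃] [Module Aᵐᵒᵖ M₁]
    [Module Aᵐᵒᵖ M₂] [Module Aᵐᵒᵖ M₃] (f : M₁ →ₗ[Aᵐᵒᵖ] M₂) (g : M₂ →ₗ[Aᵐᵒᵖ] M₃)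
    (hfg : g ∘ₗ f = 0) :
    (∀ x, map A N g x = 0 → ∃ y, map A N f y = x) ↔ (∀ x, g x = 0 → ∃ y, f y = x) := by
  constructor
  · intro h x hx
    obtain ⟨y, hy⟩ := h (tmul A M₂ N x (ι 1)) (by rw [map_tmul, hx, map_zero]; rfl)
    -- The class of `x` in the cokernel of `f` dies in `coker f ⊗ N`, so it is zero by purity.
    have h0 : (LinearMap.range f).mkQ x = 0 := by
      apply tmul_map_one_injective hι hflat
      change tmul A _ N ((LinearMap.range f).mkQ x) (ι 1) = tmul A _ N 0 (ι 1)
      have hz : (LinearMap.range f).mkQ ∘ₗ f = 0 := LinearMap.range_mkQ_comp f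
      rw [← map_tmul, ← hy, map_map, hz, map_zero]
      exact DFunLike.congr_fun (f := map A N (0 : M₁ →ₗ[Aᵐᵒᵖ] M₂ ⧸ LinearMap.range f)) (g := 0)
        (hom_ext_tmul fun m n => by simp) y
    exact (Submodule.Quotient.mk_eq_zero _).mp h0
  · intro h x hx
    apply exists_map_eq (LinearMap.exact_map_mkQ_range f) (Submodule.mkQ_surjective _)
    have hle : LinearMap.range f ≤ LinearMap.ker g := LinearMap.range_le_ker_iff.mpr hfg
    let g' := (LinearMap.range f).liftQ g hle
    have hg' : Function.Injective g' := by
      rw [← LinearMap.ker_eq_bot]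
      exact Submodule.ker_liftQ_eq_bot _ _ _ fun z hz => h z hz
    apply isFlat_of_isFlat_quotient hι hflat _ _ g' hg'
    rw [map_map, map_zero, ← hx]
    rfl

end Flat

/-! ### Change of rings -/

section ChangeOfRings

open BalancedTensor

variable {A : Type*} [Ring A] {B : Type*} [Ring B] [Module A B] [IsScalarTower A B B]
  {M : Type*} [AddCommGroup M] [Module Aᵐᵒᵖ M] {M' : Type*} [AddCommGroup M'] [Module Aᵐᵒᵖ M']
  {N : Type*} [AddCommGroup N] [Module B N] [Module A N] [IsScalarTower A B N]

variable (A) in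
/-- Right multiplication by `b`, as a map of left `A`-modules. -/
def mulRightLinear (b : B) : B →ₗ[A] B where
  toFun x := x * b
  map_add' x y := add_mul x y b
  map_smul' a x := smul_mul_assoc a x b

/-- The right `B`-module structure of `M ⊗_A B`, with `(m ⊗ x) b = m ⊗ (x b)`. -/
instance BalancedTensor.instModuleMop : Module Bᵐᵒᵖ (BalancedTensor A M B) where
  smul b := lTensor M (mulRightLinear A b.unop)
  one_smul x := by
    refine DFunLike.congr_fun (g := AddMonoidHom.id _) (hom_ext_tmul fun m c => ?_) x
    exact congrArg (tmul A M B m) (mul_one c)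
  mul_smul b b' x := by
    refine DFunLike.congr_fun (g := (lTensor M (mulRightLinear A b.unop)).comp
      (lTensor M (mulRightLinear A b'.unop))) (hom_ext_tmul fun m c => ?_) x
    exact congrArg (tmul A M B m) (mul_assoc c b'.unop b.unop).symm
  smul_zero b := map_zero (lTensor M (mulRightLinear A b.unop))
  smul_add b := map_add (lTensor M (mulRightLinear A b.unop))
  add_smul b b' x := by
    refine DFunLike.congr_fun (g := lTensor M (mulRightLinear A b.unop) +
      lTensor M (mulRightLinear A b'.unop)) (hom_ext_tmul fun m c => ?_) x
    exact (congrArg (tmul A M B m) (mul_add c b.unop b'.unop)).trans (map_add _ _ _)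
  zero_smul x := by
    refine DFunLike.congr_fun (g := 0) (hom_ext_tmul fun m c => ?_) x
    exact (congrArg (tmul A M B m) (mul_zero c)).trans (map_zero _)

lemma BalancedTensor.op_smul_tmul (b : B) (m : M) (c : B) :
    op b • tmul A M B m c = tmul A M B m (c * b) := rfl

variable (B) in
/-- `f ⊗ id : M ⊗_A B → M' ⊗_A B` as a map of right `B`-modules. -/
def BalancedTensor.mapLinear (f : M →ₗ[Aᵐᵒᵖ] M') :
    BalancedTensor A M B →ₗ[Bᵐᵒᵖ] BalancedTensor A M' B where
  toFun := map A B f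
  map_add' := map_add _
  map_smul' b x := (lTensor_map f (mulRightLinear A b.unop) x).symm

variable (A B M N) in
/-- The isomorphism `(M ⊗_A B) ⊗_B N ≃ M ⊗_A N`, `(m ⊗ b) ⊗ n ↦ m ⊗ (b n)`. -/
def BalancedTensor.cancelBaseChange :
    BalancedTensor B (BalancedTensor A M B) N ≃+ BalancedTensor A M N where
  toFun := lift (AddMonoidHom.flip (AddMonoidHom.mk' (fun n =>
      lTensor M (LinearMap.toSpanSingleton B N n |>.restrictScalars A)) fun n n' =>
        hom_ext_tmul fun m b =>
          (congrArg (tmul A M N m) (smul_add b n n')).trans (map_add _ _ _))) fun x b n => by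
    change lTensor M _ (lTensor M _ x) = lTensor M _ x
    rw [lTensor_lTensor]
    congr 2
    ext c
    exact mul_smul c b n
  invFun := lift ((tmul B (BalancedTensor A M B) N).comp ((tmul A M B).flip 1)) fun m a n => by
    change tmul B _ N (tmul A M B (op a • m) 1) n = tmul B _ N (tmul A M B m 1) (a • n)
    rw [smul_tmul, ← one_mul (a • (1 : B)), ← op_smul_tmul, smul_tmul, smul_assoc, one_smul]
  map_add' := map_add _
  left_inv x := by
    induction x using induction_on with
    | tmul x n =>
      induction x using induction_on with
      | tmul m b =>
        change tmul B _ N (tmul A M B m 1) (b • n) = _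
        rw [← smul_tmul, op_smul_tmul, one_mul]
      | add x y hx hy =>
        simp only [map_add, AddMonoidHom.add_apply] at hx hy ⊢
        rw [hx, hy]
    | add x y hx hy => rw [map_add, map_add, hx, hy]
  right_inv x := by
    induction x using induction_on with
    | tmul m n => exact congrArg (tmul A M N m) (one_smul B n)
    | add x y hx hy => rw [map_add, map_add, hx, hy]

lemma BalancedTensor.cancelBaseChange_map (f : M →ₗ[Aᵐᵒᵖ] M')
    (x : BalancedTensor B (BalancedTensor A M B) N) :
    cancelBaseChange A B M' N (map B N (mapLinear B f) x) =
      map A N f (cancelBaseChange A B M N x) := by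
  induction x using induction_on with
  | tmul x n =>
    exact lTensor_map f (LinearMap.toSpanSingleton B N n |>.restrictScalars A) x
  | add x y hx hy => simp only [map_add, hx, hy]

end ChangeOfRings

/-- For a complex `M₁ → M₂ → M₃` of right `A`-modules, exactness of `M_• ⊗_A B` and of
`M_• ⊗_A N` are equivalent, because `M_• ⊗_A N = (M_• ⊗_A B) ⊗_B N`. -/
lemma exact_map_iff_exact_map {A B N : Type u} [Ring A] [Ring B] [Module A B]
    [IsScalarTower A B B] [AddCommGroup N] [Module B N] [Module A N] [IsScalarTower A B N]
    {ι : B →ₗ[B] N} (hι : Function.Injective ι) (hflat : IsFlat B (N ⧸ LinearMap.range ι))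
    {M₁ M₂ M₃ : Type u} [AddCommGroup M₁] [AddCommGroup M₂] [AddCommGroup M₃] [Module Aᵐᵒᵖ M₁]
    [Module Aᵐᵒᵖ M₂] [Module Aᵐᵒᵖ M₃] (f : M₁ →ₗ[Aᵐᵒᵖ] M₂) (g : M₂ →ₗ[Aᵐᵒᵖ] M₃)
    (hfg : g ∘ₗ f = 0) :
    (∀ x, BalancedTensor.map A B g x = 0 → ∃ y, BalancedTensor.map A B f y = x) ↔
      (∀ x, BalancedTensor.map A N g x = 0 → ∃ y, BalancedTensor.map A N f y = x) := by
  have hcomp : BalancedTensor.mapLinear B g ∘ₗ BalancedTensor.mapLinear B f = 0 := by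
    ext x
    induction x using BalancedTensor.induction_on with
    | tmul m b =>
      have : g (f m) = 0 := LinearMap.congr_fun hfg m
      change BalancedTensor.tmul A M₃ B (g (f m)) b = 0
      rw [this, map_zero, AddMonoidHom.zero_apply]
    | add x y hx hy => rw [map_add, hx, hy, map_add]
  refine (exact_map_iff hι hflat (BalancedTensor.mapLinear B f) (BalancedTensor.mapLinear B g)
    hcomp).symm.trans ?_
  let e₁ := BalancedTensor.cancelBaseChange A B M₁ N
  let e₂ := BalancedTensor.cancelBaseChange A B M₂ N
  let e₃ := BalancedTensor.cancelBaseChange A B M₃ N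
  refine e₂.toEquiv.forall_congr fun {x} => imp_congr ?_ (e₁.toEquiv.exists_congr fun y => ?_)
  · rw [← e₃.map_eq_zero_iff]
    exact Eq.congr_left (BalancedTensor.cancelBaseChange_map g x)
  · rw [← e₂.apply_eq_iff_eq]
    exact Eq.congr_left (BalancedTensor.cancelBaseChange_map f y)

/-! ### Vanishing of homology with coefficients -/

section Homology

variable {X : Type u} [TopologicalSpace X] (x₀ : X)

/-- `H_i(X; M) = 0` says that `C_{i+1} ⊗ M → C_i ⊗ M → C_{i-1} ⊗ M` is exact. For `i = 0` the last
term comes from the zero map that the short complex `sc 0` contains by convention. -/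
lemma subsingleton_homology_iff (M : Type u) [AddCommGroup M]
    [Module (MonoidAlgebra ℤ (FundamentalGroup X x₀)) M] (i : ℕ) :
    Subsingleton (Homology x₀ M i) ↔
      ∀ x, BalancedTensor.map _ M ((chainsUC x₀).sc i).g.hom x = 0 →
        ∃ y, BalancedTensor.map _ M ((chainsUC x₀).sc i).f.hom y = x := by
  rw [← AddCommGrpCat.isZero_iff_subsingleton, Homology,
    ← HomologicalComplex.exactAt_iff_isZero_homology, HomologicalComplex.exactAt_iff,
    ShortComplex.ab_exact_iff]
  rfl

/-- For each single degree, homology with coefficients in `R'` vanishes if and only if homology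
with coefficients in `R` does. -/
lemma subsingleton_homology_iff_of_isFlat {R' R : Type u} [Ring R']
    [Module (MonoidAlgebra ℤ (FundamentalGroup X x₀)) R']
    [IsScalarTower (MonoidAlgebra ℤ (FundamentalGroup X x₀)) R' R']
    [AddCommGroup R] [Module R' R] [Module (MonoidAlgebra ℤ (FundamentalGroup X x₀)) R]
    [IsScalarTower (MonoidAlgebra ℤ (FundamentalGroup X x₀)) R' R]
    {ι : R' →ₗ[R'] R} (hι : Function.Injective ι) (hflat : IsFlat R' (R ⧸ LinearMap.range ι))
    (i : ℕ) : Subsingleton (Homology x₀ R' i) ↔ Subsingleton (Homology x₀ R i) := by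
  rw [subsingleton_homology_iff, subsingleton_homology_iff]
  exact exact_map_iff_exact_map hι hflat _ _
    (congrArg ModuleCat.Hom.hom ((chainsUC x₀).sc i).zero)

end Homology

/-! ### Real and imaginary parts in the reduced group `C*`-algebra -/

section CStar

variable {G : Type u}

/-- The complex conjugate `f ↦ conj (T (conj f))` of an operator on `l²(G)`. -/
def conjFun (T : L2 G →L[ℂ] L2 G) : L2 G →L[ℂ] L2 G :=
  LinearMap.mkContinuous
    { toFun := fun f => star (T (star f))
      map_add' := fun f g => by rw [star_add, map_add, star_add]
      map_smul' := fun c f => by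
        rw [star_smul, map_smul, star_smul, star_star, RingHom.id_apply] } ‖T‖
    fun f => (norm_star (T (star f))).trans_le ((T.le_opNorm _).trans_eq (by rw [norm_star]))

/-- Complex conjugation of operators on `l²(G)`, as a continuous real linear map. -/
def conjOp : (L2 G →L[ℂ] L2 G) →L[ℝ] (L2 G →L[ℂ] L2 G) :=
  LinearMap.mkContinuous
    { toFun := conjFun
      map_add' := fun S T => ContinuousLinearMap.ext fun f => star_add (S (star f)) (T (star f))
      map_smul' := fun c T => ContinuousLinearMap.ext fun f => by
        change star (c • T (star f)) = c • star (T (star f))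
        ext x
        simp } 1
    fun T => by
      rw [one_mul]
      exact (conjFun T).opNorm_le_bound (norm_nonneg T) fun f =>
        (norm_star (T (star f))).trans_le ((T.le_opNorm _).trans_eq (by rw [norm_star]))

lemma conjOp_apply (T : L2 G →L[ℂ] L2 G) (f : L2 G) : conjOp T f = star (T (star f)) := rfl

lemma conjOp_mul (S T : L2 G →L[ℂ] L2 G) : conjOp (S * T) = conjOp S * conjOp T := by
  ext1 f
  simp [conjOp_apply]

lemma conjOp_smul (c : ℂ) (T : L2 G →L[ℂ] L2 G) : conjOp (c • T) = star c • conjOp T := by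
  ext1 f
  simp [conjOp_apply]

/-- The imaginary part `(T - conj T) / 2i` of an operator on `l²(G)`. -/
def imOp : (L2 G →L[ℂ] L2 G) →L[ℝ] (L2 G →L[ℂ] L2 G) :=
  (-(Complex.I / 2)) • (ContinuousLinearMap.id ℝ _ - conjOp)

lemma imOp_apply (T : L2 G →L[ℂ] L2 G) : imOp T = (-(Complex.I / 2)) • (T - conjOp T) := rfl

lemma imOp_eq_zero_iff {T : L2 G →L[ℂ] L2 G} : imOp T = 0 ↔ conjOp T = T := by
  rw [imOp_apply, smul_eq_zero_iff_right (by simp), sub_eq_zero, eq_comm]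

lemma imOp_I_smul {T : L2 G →L[ℂ] L2 G} (hT : conjOp T = T) : imOp (Complex.I • T) = T := by
  have : -(Complex.I / 2) * (Complex.I - star Complex.I) = 1 := by
    rw [Complex.star_def, Complex.conj_I]
    linear_combination -Complex.I_mul_I
  rw [imOp_apply, conjOp_smul, hT, ← sub_smul, smul_smul, this, one_smul]

lemma imOp_mul {S : L2 G →L[ℂ] L2 G} (hS : conjOp S = S) (T : L2 G →L[ℂ] L2 G) :
    imOp (S * T) = S * imOp T := by
  rw [imOp_apply, imOp_apply, conjOp_mul, hS, ← mul_sub, mul_smul_comm]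

variable [Group G]

lemma conjOp_leftRegular (g : G) : conjOp (leftRegular G g) = leftRegular G g := by
  ext f x
  change star (star (f (g⁻¹ * x))) = f (g⁻¹ * x)
  exact star_star _

/-- Operators in `C*_ℝ(G)` commute with complex conjugation of functions. -/
lemma conjOp_eq_of_mem {T : L2 G →L[ℂ] L2 G} (hT : T ∈ realReduced G) : conjOp T = T := by
  have hcl : IsClosed {T : L2 G →L[ℂ] L2 G | conjOp T = T} :=
    isClosed_eq conjOp.continuous continuous_id
  refine closure_minimal ?_ hcl hT
  rintro _ ⟨a, rfl⟩
  rw [Set.mem_ofPred_eq]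
  induction a using MonoidAlgebra.induction_linear with
  | zero => simp
  | add a b ha hb => simp_all
  | single g r => simp [conjOp_leftRegular]

/-- It suffices to check this on `ℂ[G]`, where taking the imaginary part of an operator amounts to
taking the imaginary parts of the coefficients. -/
lemma imOp_mem {T : L2 G →L[ℂ] L2 G} (hT : T ∈ complexReduced G) : imOp T ∈ realReduced G := by
  have hcl : IsClosed {T : L2 G →L[ℂ] L2 G | imOp T ∈ realReduced G} :=
    (Subalgebra.isClosed_topologicalClosure _).preimage imOp.continuous
  refine closure_minimal ?_ hcl hT
  rintro _ ⟨a, rfl⟩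
  rw [Set.mem_ofPred_eq]
  induction a using MonoidAlgebra.induction_linear with
  | zero => simp
  | add a b ha hb =>
    rw [map_add, map_add]
    exact add_mem ha hb
  | single g c =>
    have him : imOp (c • leftRegular G g) = c.im • leftRegular G g := by
      rw [imOp_apply, conjOp_smul, conjOp_leftRegular, ← sub_smul, smul_smul]
      refine Eq.trans (congrArg (· • leftRegular G g) ?_) (Complex.coe_smul c.im (leftRegular G g))
      rw [Complex.star_def, Complex.sub_conj, Complex.ofReal_mul, Complex.ofReal_ofNat]
      linear_combination -(c.im : ℂ) * Complex.I_mul_I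
    change imOp (MonoidAlgebra.lift ℂ _ _ (leftRegular G) (MonoidAlgebra.single g c)) ∈ _
    rw [MonoidAlgebra.lift_single, him]
    exact Subalgebra.smul_mem _ (toRealReduced G g).2 c.im

lemma realReduced_le : realReduced G ≤ (complexReduced G).restrictScalars ℝ := by
  refine Subalgebra.topologicalClosure_minimal ?_ (Subalgebra.isClosed_topologicalClosure _)
  rintro _ ⟨a, rfl⟩
  induction a using MonoidAlgebra.induction_linear with
  | zero => exact (map_zero (MonoidAlgebra.lift ℝ _ _ (leftRegular G))) ▸ zero_mem _
  | add a b ha hb =>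
    have := add_mem ha hb
    rwa [← map_add] at this
  | single g r =>
    change MonoidAlgebra.lift ℝ _ _ (leftRegular G) (MonoidAlgebra.single g r) ∈ _
    rw [MonoidAlgebra.lift_single]
    exact Subalgebra.smul_mem _ (toComplexReduced G g).2 r

/-- An operator `T` that commutes with complex conjugation is the imaginary part of `i T`. -/
lemma mem_realReduced_of_conjOp_eq {T : L2 G →L[ℂ] L2 G} (hT : T ∈ complexReduced G)
    (h : conjOp T = T) : T ∈ realReduced G := by
  rw [← imOp_I_smul h]
  exact imOp_mem (Subalgebra.smul_mem _ hT Complex.I)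

variable (G) in
/-- The inclusion `C*_ℝ(G) → C*_r(G)` as a ring homomorphism. -/
def realInclusion : realReduced G →+* complexReduced G where
  toFun a := ⟨a, realReduced_le a.2⟩
  map_one' := rfl
  map_mul' _ _ := rfl
  map_zero' := rfl
  map_add' _ _ := rfl

/-- `C*_r(G)` as a left module over its subring `C*_ℝ(G)`. -/
instance : Module (realReduced G) (complexReduced G) :=
  Module.compHom _ (realInclusion G)

lemma coe_realReduced_smul (a : realReduced G) (T : complexReduced G) :
    ((a • T : complexReduced G) : L2 G →L[ℂ] L2 G) = a * T := rfl

lemma coe_smul_realReduced (z : MonoidAlgebra ℤ G) (a : realReduced G) :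
    ((z • a : realReduced G) : L2 G →L[ℂ] L2 G) =
      MonoidAlgebra.lift ℤ _ _ (leftRegular G) z * a := by
  change ((MonoidAlgebra.lift ℤ _ _ (toRealReduced G) z * a : realReduced G) :
    L2 G →L[ℂ] L2 G) = _
  rw [MulMemClass.coe_mul]
  congr 1
  induction z using MonoidAlgebra.induction_linear with
  | zero => simp
  | add a b ha hb => simp_all
  | single g k => rw [MonoidAlgebra.lift_single, MonoidAlgebra.lift_single]; rfl

lemma coe_smul_complexReduced (z : MonoidAlgebra ℤ G) (T : complexReduced G) :
    ((z • T : complexReduced G) : L2 G →L[ℂ] L2 G) =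
      MonoidAlgebra.lift ℤ _ _ (leftRegular G) z * T := by
  change ((MonoidAlgebra.lift ℤ _ _ (toComplexReduced G) z * T : complexReduced G) :
    L2 G →L[ℂ] L2 G) = _
  rw [MulMemClass.coe_mul]
  congr 1
  induction z using MonoidAlgebra.induction_linear with
  | zero => simp
  | add a b ha hb => simp_all
  | single g k => rw [MonoidAlgebra.lift_single, MonoidAlgebra.lift_single]; rfl

instance : IsScalarTower (MonoidAlgebra ℤ G) (realReduced G) (realReduced G) where
  smul_assoc z a b := Subtype.ext <| by
    simp only [smul_eq_mul, MulMemClass.coe_mul, coe_smul_realReduced, mul_assoc]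

instance : IsScalarTower (MonoidAlgebra ℤ G) (realReduced G) (complexReduced G) where
  smul_assoc z a T := Subtype.ext <| by
    simp only [coe_realReduced_smul, coe_smul_complexReduced, coe_smul_realReduced, mul_assoc]

variable (G) in
/-- The inclusion `C*_ℝ(G) → C*_r(G)` of left `C*_ℝ(G)`-modules. -/
def realToComplex : realReduced G →ₗ[realReduced G] complexReduced G where
  toFun := realInclusion G
  map_add' _ _ := rfl
  map_smul' _ _ := rfl

lemma realToComplex_injective : Function.Injective (realToComplex G) := fun _ _ h =>
  Subtype.ext (congrArg (fun T : complexReduced G => (T : L2 G →L[ℂ] L2 G)) h)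

variable (G) in
/-- The imaginary part `C*_r(G) → C*_ℝ(G)`, a map of left `C*_ℝ(G)`-modules. -/
def imLinear : complexReduced G →ₗ[realReduced G] realReduced G where
  toFun T := ⟨imOp T, imOp_mem T.2⟩
  map_add' S T := Subtype.ext (map_add imOp (S : L2 G →L[ℂ] L2 G) T)
  map_smul' a T := Subtype.ext (imOp_mul (conjOp_eq_of_mem a.2) T)

lemma imLinear_surjective : Function.Surjective (imLinear G) := fun a =>
  ⟨⟨Complex.I • (a : L2 G →L[ℂ] L2 G), (complexReduced G).smul_mem (realReduced_le a.2) Complex.I⟩,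
    Subtype.ext (imOp_I_smul (conjOp_eq_of_mem a.2))⟩

lemma ker_imLinear : LinearMap.ker (imLinear G) = LinearMap.range (realToComplex G) := by
  ext T
  constructor
  · intro h
    have h' : imOp (T : L2 G →L[ℂ] L2 G) = 0 := congrArg Subtype.val (LinearMap.mem_ker.mp h)
    exact ⟨⟨T, mem_realReduced_of_conjOp_eq T.2 (imOp_eq_zero_iff.mp h')⟩, rfl⟩
  · rintro ⟨a, rfl⟩
    exact LinearMap.mem_ker.mpr (Subtype.ext (imOp_eq_zero_iff.mpr (conjOp_eq_of_mem a.2)))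

/-- The imaginary part identifies `C*_r(G) / C*_ℝ(G)` with the free module `C*_ℝ(G)`. -/
lemma isFlat_complexReduced_quotient :
    IsFlat (realReduced G) (complexReduced G ⧸ LinearMap.range (realToComplex G)) :=
  isFlat_self.of_linearEquiv
    ((Submodule.quotEquivOfEq _ _ ker_imLinear.symm).trans
      ((imLinear G).quotKerEquivOfSurjective imLinear_surjective)).symm

end CStar

end FlatCoeff

end

theorem mainTheorem8 {X : Type u} [TopologicalSpace X] [T2Space X] [ConnectedSpace X]
    [Topology.CWComplex (Set.univ : Set X)] (x₀ : X) :
    (∀ (R' R : Type u) [Ring R'] [Module (MonoidAlgebra ℤ (FundamentalGroup X x₀)) R']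
      [IsScalarTower (MonoidAlgebra ℤ (FundamentalGroup X x₀)) R' R']
      [AddCommGroup R] [Module R' R] [Module (MonoidAlgebra ℤ (FundamentalGroup X x₀)) R]
      [IsScalarTower (MonoidAlgebra ℤ (FundamentalGroup X x₀)) R' R]
      (ι : R' →ₗ[R'] R), Function.Injective ι →
      FlatCoeff.IsFlat R' (R ⧸ LinearMap.range ι) →
      ∀ n : ℕ, FlatCoeff.HomologyVanishesUpTo x₀ R' n ↔ FlatCoeff.HomologyVanishesUpTo x₀ R n) ∧
    (∀ n : ℕ,
      FlatCoeff.HomologyVanishesUpTo x₀ (FlatCoeff.realReduced (FundamentalGroup X x₀)) n ↔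
      FlatCoeff.HomologyVanishesUpTo x₀ (FlatCoeff.complexReduced (FundamentalGroup X x₀)) n) := by
  refine ⟨fun R' R _ _ _ _ _ _ _ ι hι hflat n => ?_, fun n => ?_⟩
  · exact forall₂_congr fun i _ => FlatCoeff.subsingleton_homology_iff_of_isFlat x₀ hι hflat i
  · exact forall₂_congr fun i _ => FlatCoeff.subsingleton_homology_iff_of_isFlat x₀
      (ι := FlatCoeff.realToComplex (FundamentalGroup X x₀))
      FlatCoeff.realToComplex_injective FlatCoeff.isFlat_complexReduced_quotient i
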